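/- For integers $d, a, b, n \ge 1$ with $b \le d+2$, let $q_d^{(a)}(n)$ be the number of partitions of $n$ into parts that are all at least $a$ and any two of which (counted with multiplicity) differ by at least $d$; let $Q_d^{(b,-,-)}(n)$ be the number of partitions of $n$ into parts congruent to $\pm b$ modulo $d+3$, none of which is equal to $b$ or to $d+3-b$; and let $\Delta_d^{(a,-,-)}(n) = q_d^{(a)}(n) - Q_d^{(a,-,-)}(n)$. Theorem. Let $a \ge 3$ and $d \ge 31a-3$ be integers such that $a$ divides $d+3$. Then $\Delta_d^{(a,-,-)}(n) \ge 0$ for all $n \ge 1$. -/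

import Mathlib

namespace AlderPartitions

/-- The partitions of `n` counted by `q_d^{(a)}(n)`: all parts are at least `a`, and, listing the
parts in non-increasing order with multiplicity, any two of them differ by at least `d`. -/
def gapPartitions (d a n : ℕ) : Finset n.Partition :=
  {p | (∀ x ∈ p.parts, a ≤ x) ∧ (p.parts.sort (· ≥ ·)).Pairwise (fun x y => y + d ≤ x)}

/-- `q_d^{(a)}(n)`. -/
def q (d a n : ℕ) : ℕ := (gapPartitions d a n).card

/-- The partitions of `n` counted by `Q_d^{(b,-,-)}(n)`: every part is congruent to `b` or `-b`
modulo `d + 3`, and is neither `b` nor `d + 3 - b`. -/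
def residuePartitions (d b n : ℕ) : Finset n.Partition :=
  {p | ∀ x ∈ p.parts,
    ((x : ℤ) ≡ (b : ℤ) [ZMOD (d : ℤ) + 3] ∨ (x : ℤ) ≡ -(b : ℤ) [ZMOD (d : ℤ) + 3]) ∧
      (x : ℤ) ≠ (b : ℤ) ∧ (x : ℤ) ≠ (d : ℤ) + 3 - (b : ℤ)}

/-- `Q_d^{(b,-,-)}(n)`. -/
def QDashDash (d b n : ℕ) : ℕ := (residuePartitions d b n).card

/-- `Δ_d^{(a,b,-,-)}(n) = q_d^{(a)}(n) - Q_d^{(b,-,-)}(n)`, an integer. -/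
def deltaDashDash₂ (d a b n : ℕ) : ℤ := (q d a n : ℤ) - (QDashDash d b n : ℤ)

/-- `Δ_d^{(a,-,-)}(n) = Δ_d^{(a,a,-,-)}(n)`. -/
def deltaDashDash (d a n : ℕ) : ℤ := deltaDashDash₂ d a a n

end AlderPartitions

open Finset

namespace AlderPartitions

/-! Write `d + 3 = a * m`, so `m ≥ 31`. Dividing by `a`, it suffices to inject partitions of `N = n
/ a` into parts greater than `m` congruent to `±1` modulo `m` into partitions of `N` whose parts
differ by at least `m`; multiplied by `a`, the gaps become `d + 3`.

Expand each multiplicity in binary. A digit of value `2 ^ k * partVal m s j` is replaced by a part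
`2 ^ i + m * u` with `i < 5`, smaller by at least `m`; different digits receive different parts
(`place_injective`, `placeVal_le`). Distinct parts of this kind are merged, one class `i` at a time,
into a partition with gaps `m`. This merging is reversible because remainders record how each part
was inserted (`combine_injective`, `code_injective`).

The sum lost is restored as one new largest part. To make that part large enough, the largest digit
with exponent `0` or `1`, if any, is first discarded (`sum_trim_add_le`). Its value is recovered
from the total, and the value determines the digit (`trim_injective`). -/

/-! ### Sorted entries of multisets. -/

/-- The entries of a multiset in non-increasing order, followed by zeros. -/
noncomputable def desc (W : Multiset ℕ) (i : ℕ) : ℕ := (W.sort (· ≥ ·)).getD i 0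

theorem map_range_desc (W : Multiset ℕ) : (Multiset.range W.card).map (desc W) = W := by
  have h : (List.range W.card).map (desc W) = W.sort (· ≥ ·) := by
    apply List.ext_getElem
    · simp
    · intro i h1 h2
      rw [List.getElem_map, List.getElem_range, desc, List.getD_eq_getElem _ _ h2]
  calc (Multiset.range W.card).map (desc W) = ((List.range W.card).map (desc W) : List ℕ) := rfl
    _ = W := by rw [h, Multiset.sort_eq]

theorem desc_anti (W : Multiset ℕ) {i j : ℕ} (hij : i ≤ j) (hj : j < W.card) :
    desc W j ≤ desc W i := by
  have hj' : j < (W.sort (· ≥ ·)).length := by simpa using hj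
  have hs := W.pairwise_sort (· ≥ ·)
  rcases hij.eq_or_lt with rfl | hlt
  · exact le_rfl
  · rw [List.pairwise_iff_getElem] at hs
    rw [desc, desc, List.getD_eq_getElem _ _ hj', List.getD_eq_getElem _ _ (hlt.trans hj')]
    exact hs i j _ _ hlt

theorem desc_strictAnti (U : Finset ℕ) {i j : ℕ} (hij : i < j) (hj : j < #U) :
    desc U.val j < desc U.val i := by
  refine lt_of_le_of_ne (desc_anti U.val hij.le hj) fun h => ?_
  have hnd : ((Multiset.range U.val.card).map (desc U.val)).Nodup := by
    rw [map_range_desc]; exact U.nodup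
  have := (Multiset.nodup_map_iff_inj_on (Multiset.nodup_range _)).1 hnd j
    (by simpa using hj) i (by simpa using hij.trans hj) h
  omega

theorem desc_mem (W : Multiset ℕ) {i : ℕ} (hi : i < W.card) : desc W i ∈ W := by
  have h := Multiset.mem_map_of_mem (desc W) (Multiset.mem_range.2 hi)
  rwa [map_range_desc] at h

theorem sort_map_range {k : ℕ} {f : ℕ → ℕ} (hf : ∀ i j, i < j → j < k → f j ≤ f i) :
    ((Multiset.range k).map f).sort (· ≥ ·) = (List.range k).map f := by
  refine List.Perm.eq_of_pairwise (le := (· ≥ ·)) (fun a b _ _ h1 h2 => le_antisymm h2 h1)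
    (Multiset.pairwise_sort _ _) ?_ ?_
  · rw [List.pairwise_iff_getElem]
    intro i j hi hj hij
    simp only [List.length_map, List.length_range] at hi hj
    simpa using hf i j hij hj
  · rw [← Multiset.coe_eq_coe, Multiset.sort_eq]
    rfl

theorem eq_of_map_range_eq {k : ℕ} {f g : ℕ → ℕ} (hf : ∀ i j, i < j → j < k → f j ≤ f i)
    (hg : ∀ i j, i < j → j < k → g j ≤ g i)
    (h : (Multiset.range k).map f = (Multiset.range k).map g) : ∀ i < k, f i = g i := by
  intro i hi
  have h1 : (List.range k).map f = (List.range k).map g := by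
    rw [← sort_map_range hf, ← sort_map_range hg, h]
  exact List.map_inj_left.1 h1 i (by simpa using hi)

/-- A multiset is determined by its cardinality and its entries in non-increasing order. -/
theorem eq_of_desc_eq {W W' : Multiset ℕ} (hc : W.card = W'.card)
    (h : ∀ i < W.card, desc W i = desc W' i) : W = W' := by
  rw [← map_range_desc W, ← map_range_desc W', ← hc]
  exact Multiset.map_congr rfl fun i hi => h i (by simpa using hi)

/-! ### Inserting one residue class into a partition with gaps `m`. -/

/-- The size of the partition obtained from the multiset `W` of size `k` by adding `1` to all
entries and `m * (k - 1), ..., m, 0` to them in non-increasing order. -/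
def weight (m : ℕ) (W : Multiset ℕ) : ℕ := (W.map (· + 1)).sum + m * ∑ i ∈ range W.card, i

section Combine

variable (m p : ℕ) (W : Multiset ℕ) (U : Finset ℕ)

/-- The entries of `W` after the elements of `U` below the size of `W` have been absorbed. -/
noncomputable def absorbed (i : ℕ) : ℕ :=
  desc W i + m * #{u ∈ U | u < W.card ∧ i < u} + if i ∈ U then p + 1 else 0

/-- The elements of `U` which are at least the size `k` of `W`. -/
def large (k : ℕ) : Finset ℕ := {u ∈ U | k ≤ u}

/-- The new entries contributed by the elements of `U` which are at least `k`. -/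
noncomputable def appended (k i : ℕ) : ℕ :=
  p + m * (desc (large U k).val i - (k + (#(large U k) - 1 - i)))

/-- Insertion of parts congruent to `p + 1` into a partition whose parts differ by at least `m`
and leave remainders `1, ..., p`, in terms of the multisets that remain after removal of the
staircase with steps `m`. -/
noncomputable def combine : Multiset ℕ :=
  (Multiset.range W.card).map (absorbed m p W U) +
    (Multiset.range #(large U W.card)).map (appended m p U W.card)

theorem card_combine : (combine m p W U).card = W.card + #(large U W.card) := by
  simp [combine]

variable {m p W U}

/-- An element `j` of `U` adds `p + 1` to entry `j`, but `m > p` to every earlier entry, so the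
order survives. -/
theorem absorbed_anti (hp : p < m) {i j : ℕ} (hij : i < j) (hj : j < W.card) :
    absorbed m p W U j ≤ absorbed m p W U i := by
  have h1 := desc_anti W hij.le hj
  have h2 : #{u ∈ U | u < W.card ∧ j < u} + (if j ∈ U then 1 else 0) ≤
      #{u ∈ U | u < W.card ∧ i < u} := by
    split_ifs with h
    · rw [← card_insert_of_notMem (a := j) (by simp)]
      refine card_le_card fun x => ?_
      simp only [mem_insert, mem_filter]
      rintro (rfl | hx)
      · exact ⟨h, hj, hij⟩
      · exact ⟨hx.1, hx.2.1, by omega⟩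
    · refine card_le_card fun x => ?_
      simp only [mem_filter]
      exact fun hx => ⟨hx.1, hx.2.1, by omega⟩
  have h3 := Nat.mul_le_mul_left m h2
  rw [mul_add] at h3
  unfold absorbed
  split_ifs at h3 ⊢ <;> omega

/-- The elements are distinct and at least `k`. Hence the truncated subtraction in `appended` is
exact. -/
theorem le_desc_large (k : ℕ) {i : ℕ} (hi : i < #(large U k)) :
    k + (#(large U k) - 1 - i) ≤ desc (large U k).val i := by
  obtain ⟨s, hs⟩ : ∃ s, #(large U k) - 1 - i = s := ⟨_, rfl⟩
  rw [hs]
  induction s generalizing i with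
  | zero =>
    have := desc_mem (large U k).val hi
    rw [Finset.mem_val, large, mem_filter] at this
    exact this.2
  | succ s ih =>
    have h1 := ih (i := i + 1) (by omega) (by omega)
    have h2 := desc_strictAnti (large U k) (i := i) (j := i + 1) (by omega) (by omega)
    omega

theorem appended_anti (k : ℕ) {i j : ℕ} (hij : i < j) (hj : j < #(large U k)) :
    appended m p U k j ≤ appended m p U k i := by
  unfold appended
  refine Nat.add_le_add_left (Nat.mul_le_mul_left m ?_) p
  induction j, hij using Nat.le_induction with
  | base =>
    have := desc_strictAnti (large U k) (i := i) (j := i + 1) (by omega) (by omega)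
    simp only [Nat.succ_eq_add_one] at *
    omega
  | succ j hij ih =>
    have := desc_strictAnti (large U k) (i := j) (j := j + 1) (by omega) (by omega)
    have := ih (by omega)
    omega

theorem absorbed_mod (hp : 2 * p + 1 ≤ m) (hW : ∀ y ∈ W, y % m < p) {i : ℕ} (hi : i < W.card) :
    absorbed m p W U i % m = desc W i % m + if i ∈ U then p + 1 else 0 := by
  have h := hW _ (desc_mem W hi)
  unfold absorbed
  rw [add_right_comm, Nat.add_mul_mod_self_left, Nat.add_mod, Nat.mod_eq_of_lt (b := m)]
  · congr 1
    apply Nat.mod_eq_of_lt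
    split_ifs <;> omega
  · rw [Nat.mod_eq_of_lt (a := if i ∈ U then p + 1 else 0)] <;> split_ifs <;> omega

theorem appended_mod (hp : p < m) (k i : ℕ) : appended m p U k i % m = p := by
  rw [appended, Nat.add_mul_mod_self_left, Nat.mod_eq_of_lt hp]

theorem combine_mod (hp : 2 * p + 1 ≤ m) (hW : ∀ y ∈ W, y % m < p) :
    ∀ y ∈ combine m p W U, y % m < 2 * p + 1 := by
  intro y hy
  simp only [combine, Multiset.mem_add, Multiset.mem_map, Multiset.mem_range] at hy
  rcases hy with ⟨i, hi, rfl⟩ | ⟨i, hi, rfl⟩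
  · rw [absorbed_mod hp hW hi]
    have h := hW _ (desc_mem W hi)
    split_ifs <;> omega
  · rw [appended_mod (by omega)]; omega

/-- Absorbed entries have remainder below `p`, or between `p + 1` and `2 * p` if hit by `U`;
appended ones have remainder exactly `p`. Remainders thus separate the two halves of `combine`. -/
theorem combine_filter (hp : 2 * p + 1 ≤ m) (hW : ∀ y ∈ W, y % m < p) :
    (combine m p W U).filter (fun y => y % m ≠ p) =
        (Multiset.range W.card).map (absorbed m p W U) ∧
      (combine m p W U).filter (fun y => y % m = p) =
        (Multiset.range #(large U W.card)).map (appended m p U W.card) := by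
  have h1 : ∀ y ∈ (Multiset.range W.card).map (absorbed m p W U), y % m ≠ p := by
    intro y hy
    simp only [Multiset.mem_map, Multiset.mem_range] at hy
    obtain ⟨i, hi, rfl⟩ := hy
    rw [absorbed_mod hp hW hi]
    have h := hW _ (desc_mem W hi)
    split_ifs <;> omega
  have h2 : ∀ y ∈ (Multiset.range #(large U W.card)).map (appended m p U W.card), y % m = p := by
    intro y hy
    simp only [Multiset.mem_map, Multiset.mem_range] at hy
    obtain ⟨i, hi, rfl⟩ := hy
    exact appended_mod (by omega) _ _
  constructor
  · rw [combine, Multiset.filter_add, Multiset.filter_eq_self.2 h1, Multiset.filter_eq_nil.2,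
      add_zero]
    exact fun y hy h => h (h2 y hy)
  · rw [combine, Multiset.filter_add, Multiset.filter_eq_self.2 h2, Multiset.filter_eq_nil.2,
      zero_add]
    exact fun y hy h => h1 y hy h

/-- Both halves are monotone sequences, hence known entry by entry. Remainders above `p` reveal the
small elements of `U`, and subtracting their effect gives `W`; the appended entries give the large
elements. -/
theorem combine_injective (hp : 2 * p + 1 ≤ m) {W' : Multiset ℕ} {U' : Finset ℕ}
    (hW : ∀ y ∈ W, y % m < p) (hW' : ∀ y ∈ W', y % m < p)
    (h : combine m p W U = combine m p W' U') : W = W' ∧ U = U' := by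
  have hm : 0 < m := by omega
  obtain ⟨hA, hB⟩ := combine_filter (U := U) hp hW
  obtain ⟨hA', hB'⟩ := combine_filter (U := U') hp hW'
  rw [h, hA'] at hA
  rw [h, hB'] at hB
  have hk : W.card = W'.card := by simpa using (congrArg Multiset.card hA).symm
  have ht : #(large U W.card) = #(large U' W'.card) := by
    simpa using (congrArg Multiset.card hB).symm
  rw [← hk] at hA
  rw [← ht] at hB
  have eA := eq_of_map_range_eq (fun i j hij hj => absorbed_anti (by omega) hij (hk ▸ hj))
    (fun i j hij hj => absorbed_anti (by omega) hij hj) hA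
  have eB := eq_of_map_range_eq (fun i j hij hj => appended_anti _ hij (ht ▸ hj))
    (fun i j hij hj => appended_anti _ hij hj) hB
  have hlow : ∀ i < W.card, (i ∈ U ↔ i ∈ U') := by
    intro i hi
    have h1 := absorbed_mod (U := U) hp hW hi
    have h2 := absorbed_mod (U := U') hp hW' (hk ▸ hi)
    have h3 := hW _ (desc_mem W hi)
    have h4 := hW' _ (desc_mem W' (hk ▸ hi))
    rw [eA i hi, h1] at h2
    by_cases a : i ∈ U <;> by_cases b : i ∈ U' <;> simp only [a, b, if_true, if_false] at h2 ⊢ <;>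
      omega
  have hWW : W = W' := by
    refine eq_of_desc_eq hk fun i hi => ?_
    have h1 := eA i hi
    unfold absorbed at h1
    have h2 : ({u ∈ U | u < W.card ∧ i < u} : Finset ℕ) = {u ∈ U' | u < W'.card ∧ i < u} := by
      ext u
      simp only [mem_filter, ← hk]
      constructor
      · exact fun hu => ⟨(hlow u hu.2.1).1 hu.1, hu.2⟩
      · exact fun hu => ⟨(hlow u hu.2.1).2 hu.1, hu.2⟩
    rw [h2] at h1
    simp only [hlow i hi] at h1
    omega
  refine ⟨hWW, ?_⟩
  subst hWW
  have hBB : large U W.card = large U' W.card := by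
    rw [← Finset.val_inj]
    refine eq_of_desc_eq ht fun i hi => ?_
    have hi' : i < #(large U W.card) := hi
    have h1 := eB i hi
    have h2 := le_desc_large W.card hi'
    have h3 := le_desc_large W.card (ht ▸ hi')
    unfold appended at h1
    rw [← ht] at h1 h3
    have h4 := Nat.eq_of_mul_eq_mul_left hm (Nat.add_left_cancel h1)
    omega
  ext u
  by_cases hu : u < W.card
  · exact hlow u hu
  · have := congrArg (u ∈ ·) hBB
    simpa [large, not_lt.1 hu] using this

/-- A small `u` contributes `p + 1` once and `m` to each of the `u` earlier entries. For the large
ones, the subtracted multiples of `m` are exactly the growth of the staircase. -/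
theorem weight_combine :
    weight m (combine m p W U) = weight m W + ∑ u ∈ U, (p + 1 + m * u) := by
  set k := W.card with hk
  set t := #(large U k) with ht
  have e1 : ((combine m p W U).map (· + 1)).sum =
      ∑ i ∈ range k, (absorbed m p W U i + 1) + ∑ i ∈ range t, (appended m p U k i + 1) := by
    simp only [combine, Multiset.map_add, Multiset.map_map, Multiset.sum_add]
    rfl
  have e2 : (W.map (· + 1)).sum = ∑ i ∈ range k, (desc W i + 1) := by
    conv_lhs => rw [← map_range_desc W, Multiset.map_map]
    rfl
  have e3 : ∑ i ∈ range k, (absorbed m p W U i + 1) =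
      ∑ i ∈ range k, (desc W i + 1) + ∑ u ∈ U with u < k, (p + 1 + m * u) := by
    -- Double counting of the pairs `i < u`.
    have a1 : ∑ i ∈ range k, #{u ∈ U | u < k ∧ i < u} = ∑ u ∈ U with u < k, u := by
      have := sum_card_bipartiteAbove_eq_sum_card_bipartiteBelow (s := range k)
        (t := {u ∈ U | u < k}) (fun i u : ℕ => i < u)
      simp only [bipartiteAbove, bipartiteBelow, filter_filter] at this
      rw [this]
      refine sum_congr rfl fun u hu => ?_
      have : ({i ∈ range k | i < u} : Finset ℕ) = range u := by
        ext i
        simp only [mem_filter, mem_range] at hu ⊢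
        omega
      rw [this, card_range]
    have a2 : ∑ i ∈ range k, (if i ∈ U then p + 1 else 0) = ∑ u ∈ U with u < k, (p + 1) := by
      rw [← sum_filter]
      refine sum_congr ?_ fun _ _ => rfl
      ext i
      simp [and_comm]
    rw [sum_add_distrib (f := fun _ => p + 1), ← a2, ← mul_sum, ← a1, mul_sum,
      ← sum_add_distrib, ← sum_add_distrib]
    refine sum_congr rfl fun i _ => ?_
    unfold absorbed
    rw [← hk]
    omega
  have e4 : ∑ i ∈ range t, (appended m p U k i + 1) + m * (k * t + ∑ i ∈ range t, i) =
      ∑ u ∈ U with k ≤ u, (p + 1 + m * u) := by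
    have b1 : ∑ u ∈ large U k, (p + 1 + m * u) =
        ∑ i ∈ range t, (p + 1 + m * desc (large U k).val i) := by
      change ((large U k).val.map _).sum = _
      conv_lhs => rw [← map_range_desc (large U k).val, Multiset.map_map]
      rfl
    have b2 : m * (k * t + ∑ i ∈ range t, i) = ∑ i ∈ range t, m * (k + (t - 1 - i)) := by
      rw [← mul_sum, sum_add_distrib, sum_range_reflect (fun i => i)]
      simp [mul_comm]
    change _ = ∑ u ∈ large U k, (p + 1 + m * u)
    rw [b1, b2, ← sum_add_distrib]
    refine sum_congr rfl fun i hi => ?_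
    have h := le_desc_large (U := U) k (mem_range.1 hi)
    unfold appended
    rw [← ht] at h ⊢
    obtain ⟨x, hx⟩ := Nat.exists_eq_add_of_le h
    rw [hx, Nat.add_sub_cancel_left]
    ring
  have e5 : ∑ u ∈ U, (p + 1 + m * u) =
      ∑ u ∈ U with u < k, (p + 1 + m * u) + ∑ u ∈ U with k ≤ u, (p + 1 + m * u) := by
    rw [← sum_filter_add_sum_filter_not U (fun u => u < k)]
    simp only [not_lt]
  have e6 : ∑ i ∈ range (k + t), i = ∑ i ∈ range k, i + (k * t + ∑ i ∈ range t, i) := by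
    rw [sum_range_add, sum_add_distrib]
    simp [mul_comm]
  unfold weight
  rw [e1, e2, card_combine, ← hk, ← ht, e6, e3, e5, ← e4]
  ring

/-- For the largest `y`, the left side is the largest coded part plus `m`. Each inserted element
raises the bound by at most `m`. -/
theorem combine_le (hp : p < m) {T s : ℕ} (hW : ∀ y ∈ W, y + 1 + m * W.card ≤ T + m * s)
    (hU : ∀ u ∈ U, p + 1 + m * u + m ≤ T) :
    ∀ y ∈ combine m p W U, y + 1 + m * (combine m p W U).card ≤ T + m * (s + #U) := by
  intro y hy
  rw [card_combine]
  simp only [combine, Multiset.mem_add, Multiset.mem_map, Multiset.mem_range] at hy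
  rcases hy with ⟨i, hi, rfl⟩ | ⟨i, hi, rfl⟩
  · have h1 := hW _ (desc_mem W hi)
    have h2 : #{u ∈ U | u < W.card ∧ i < u} + (if i ∈ U then 1 else 0) + #(large U W.card) ≤
        #U := by
      rw [← card_filter_add_card_filter_not (s := U) (fun u => u < W.card)]
      refine Nat.add_le_add ?_ (by simp [large])
      split_ifs with h
      · rw [← card_insert_of_notMem (a := i) (by simp)]
        refine card_le_card fun x => ?_
        simp only [mem_insert, mem_filter]
        rintro (rfl | hx)
        · exact ⟨h, hi⟩
        · exact ⟨hx.1, hx.2.1⟩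
      · refine card_le_card fun x => ?_
        simp only [mem_filter]
        exact fun hx => ⟨hx.1, hx.2.1⟩
    have h3 := Nat.mul_le_mul_left m h2
    unfold absorbed
    simp only [mul_add] at h3 ⊢
    split_ifs at h3 ⊢ <;> omega
  · have h1 := le_desc_large (U := U) W.card hi
    have hmem := desc_mem (large U W.card).val hi
    have h2 := hU _ (mem_filter.1 hmem).1
    have h3 : #(large U W.card) ≤ #U := card_filter_le _ _
    unfold appended
    obtain ⟨x, hx⟩ := Nat.exists_eq_add_of_le h1
    rw [hx] at h2 ⊢
    rw [Nat.add_sub_cancel_left]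
    obtain ⟨z, hz⟩ : ∃ z, #(large U W.card) = i + 1 + z := ⟨_, (Nat.add_sub_cancel' hi).symm⟩
    obtain ⟨z', hz'⟩ : ∃ z', #U = i + z' := ⟨_, (Nat.add_sub_cancel' (by omega)).symm⟩
    rw [hz] at h2 ⊢
    rw [hz']
    have hz2 : i + 1 + z - 1 - i = z := by omega
    rw [hz2] at h2
    have := Nat.zero_le (m * s)
    have := Nat.zero_le (m * z')
    simp only [mul_add] at h2 ⊢
    omega

end Combine

/-! ### Iterating the insertion over the classes `2 ^ i`. -/

/-- The multiset coding the partitions into distinct parts `2 ^ i + m * u` with `u ∈ C i` and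
`i < r`. -/
noncomputable def code (m : ℕ) (C : ℕ → Finset ℕ) : ℕ → Multiset ℕ
  | 0 => 0
  | r + 1 => combine m (2 ^ r - 1) (code m C r) (C r)

section Code

variable {m : ℕ} {C : ℕ → Finset ℕ}

/-- With `p = 2 ^ r - 1`, each insertion turns the bound `p` into `2 * p + 1 = 2 ^ (r + 1) - 1`.
Five classes need `2 ^ 5 ≤ m + 1`, whence `m ≥ 31`. -/
theorem code_mod {r : ℕ} (hr : 2 ^ r ≤ m + 1) : ∀ y ∈ code m C r, y % m < 2 ^ r - 1 := by
  induction r with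
  | zero => simp [code]
  | succ r ih =>
    have : 0 < 2 ^ r := by positivity
    rw [pow_succ] at hr ⊢
    have h := combine_mod (U := C r) (p := 2 ^ r - 1) (by omega) (ih (by omega))
    intro y hy
    have := h y hy
    omega

theorem code_injective {C' : ℕ → Finset ℕ} {r : ℕ} (hr : 2 ^ r ≤ m + 1)
    (h : code m C r = code m C' r) : ∀ i < r, C i = C' i := by
  induction r with
  | zero => simp
  | succ r ih =>
    have : 0 < 2 ^ r := by positivity
    rw [pow_succ] at hr
    obtain ⟨h1, h2⟩ := combine_injective (p := 2 ^ r - 1) (by omega) (code_mod (by omega))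
      (code_mod (by omega)) h
    intro i hi
    rcases Nat.lt_succ_iff_lt_or_eq.1 hi with hi | rfl
    · exact ih (by omega) h1 i hi
    · exact h2

theorem weight_code (r : ℕ) :
    weight m (code m C r) = ∑ i ∈ range r, ∑ u ∈ C i, (2 ^ i + m * u) := by
  induction r with
  | zero => simp [code, weight]
  | succ r ih =>
    rw [code, weight_combine, ih, sum_range_succ, Nat.sub_add_cancel Nat.one_le_two_pow]

theorem code_le {r : ℕ} (hr : 2 ^ r ≤ m + 1) {T : ℕ}
    (hT : ∀ i < r, ∀ u ∈ C i, 2 ^ i + m * u + m ≤ T) :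
    ∀ y ∈ code m C r, y + 1 + m * (code m C r).card ≤ T + m * ∑ i ∈ range r, #(C i) := by
  induction r with
  | zero => simp [code]
  | succ r ih =>
    have h0 : 0 < 2 ^ r := by positivity
    rw [pow_succ] at hr
    rw [sum_range_succ]
    refine combine_le (by omega) (ih (by omega) fun i hi => hT i (by omega)) fun u hu => ?_
    have := hT r (by omega) u hu
    omega

end Code

/-! ### Binary digits and the distinct parts replacing them. -/

/-- The integers greater than `m` that are congruent to `1` (for `true`) or to `-1` (for `false`)
modulo `m`. -/
def partVal (m : ℕ) : Bool → ℕ → ℕ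
  | true, j => (j + 1) * m + 1
  | false, j => (j + 2) * m - 1

/-- The contribution to a partition of a binary digit of the multiplicity of a part. -/
def digitVal (m : ℕ) (x : Bool × ℕ × ℕ) : ℕ := 2 ^ x.2.2 * partVal m x.1 x.2.1

/-- The class and the index of the distinct part which replaces a binary digit. -/
def place : Bool × ℕ × ℕ → ℕ × ℕ
  | (true, j, 0) => (0, j)
  | (false, j, 0) => (1, j)
  | (true, j, 1) => (2, 2 * j)
  | (false, j, 1) => (2, 2 * j + 1)
  | (true, j, k + 2) => (3, 2 ^ k * (2 * j + 1) - 1)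
  | (false, j, k + 2) => (4, 2 ^ k * (2 * j + 1) - 1)

theorem two_pow_mul_odd_inj {j k j' k' : ℕ}
    (h : 2 ^ k * (2 * j + 1) = 2 ^ k' * (2 * j' + 1)) : j = j' ∧ k = k' := by
  induction k generalizing k' with
  | zero =>
    cases k' with
    | zero => omega
    | succ k' => rw [pow_succ, mul_right_comm] at h; omega
  | succ k ih =>
    cases k' with
    | zero => rw [pow_succ, mul_right_comm] at h; omega
    | succ k' =>
      rw [pow_succ, pow_succ, mul_right_comm, mul_right_comm (2 ^ k')] at h
      have := ih (k' := k') (by omega)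
      omega

theorem two_pow_mul_odd_sub_one_inj {j k j' k' : ℕ}
    (h : 2 ^ k * (2 * j + 1) - 1 = 2 ^ k' * (2 * j' + 1) - 1) : j = j' ∧ k = k' := by
  have h1 : 0 < 2 ^ k * (2 * j + 1) := by positivity
  have h2 : 0 < 2 ^ k' * (2 * j' + 1) := by positivity
  exact two_pow_mul_odd_inj (by omega)

/-- The class and, in class `2`, the parity of the index reveal the sign and whether the exponent is
`0`, `1` or larger. For larger exponents, `2 ^ k * (2 * j + 1)` determines `j` and `k`. -/
theorem place_injective : Function.Injective place := by
  rintro ⟨s, j, k⟩ ⟨s', j', k'⟩ h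
  rcases s <;> rcases s' <;> rcases k with _ | _ | k <;> rcases k' with _ | _ | k' <;>
    simp only [place, Prod.mk.injEq] at h ⊢ <;> try omega
  all_goals first
    | simp; omega
    | simp [two_pow_mul_odd_sub_one_inj h.2]

theorem place_fst_lt (x : Bool × ℕ × ℕ) : (place x).1 < 5 := by
  obtain ⟨s, j, k⟩ := x
  rcases s <;> rcases k with _ | _ | k <;> simp [place]

/-- The distinct part which replaces a binary digit. -/
def placeVal (m : ℕ) (x : Bool × ℕ × ℕ) : ℕ := 2 ^ (place x).1 + m * (place x).2

/-- The factor `2` lets such a digit pay for the new largest part by itself, without a discarded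
digit. -/
theorem two_mul_placeVal_le {m : ℕ} (hm : 31 ≤ m) {x : Bool × ℕ × ℕ} (hx : 2 ≤ x.2.2) :
    2 * (placeVal m x + m) ≤ digitVal m x := by
  obtain ⟨s, j, k⟩ := x
  obtain ⟨k, rfl⟩ : ∃ l, k = l + 2 := ⟨k - 2, by simp at hx; omega⟩
  have hq : 1 ≤ 2 ^ k := Nat.one_le_two_pow
  obtain ⟨w, hw⟩ : ∃ w, 2 ^ k * (2 * j + 1) = w + 1 :=
    ⟨_, (Nat.sub_add_cancel (Nat.mul_pos hq (by omega))).symm⟩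
  cases s
  · obtain ⟨v, hv⟩ : ∃ v, (j + 2) * m = v + 1 := ⟨_, (Nat.sub_add_cancel (by nlinarith)).symm⟩
    simp only [placeVal, place, digitVal, partVal, pow_add, hw, hv, Nat.add_sub_cancel]
    generalize 2 ^ k = q at *
    have h1 : m * w + m = q * (2 * (j * m) + m) := by
      rw [← Nat.mul_succ, Nat.succ_eq_add_one, ← hw]; ring
    have h2 : q * v + q = q * (j * m + 2 * m) := by
      rw [← Nat.mul_succ, Nat.succ_eq_add_one, ← hv]; ring
    nlinarith [mul_le_mul hq hm (by omega) (by omega), Nat.zero_le (q * (j * m))]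
  · simp only [placeVal, place, digitVal, partVal, pow_add, hw, Nat.add_sub_cancel]
    generalize 2 ^ k = q at *
    have h1 : m * w + m = q * (2 * (j * m) + m) := by
      rw [← Nat.mul_succ, Nat.succ_eq_add_one, ← hw]; ring
    nlinarith [mul_le_mul hq hm (by omega) (by omega), Nat.zero_le (q * (j * m))]

theorem placeVal_le {m : ℕ} (hm : 31 ≤ m) (x : Bool × ℕ × ℕ) :
    placeVal m x + m ≤ digitVal m x := by
  by_cases hx : 2 ≤ x.2.2
  · have := two_mul_placeVal_le hm hx
    omega
  · obtain ⟨s, j, k⟩ := x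
    have hk : k = 0 ∨ k = 1 := by simp at hx; omega
    have h0 := Nat.zero_le (j * m)
    rcases hk with rfl | rfl <;> cases s <;>
      simp only [placeVal, place, digitVal, partVal, add_mul, mul_add, mul_left_comm m 2,
        mul_comm m j] <;> omega

theorem digitVal_pos {m : ℕ} (hm : 31 ≤ m) (x : Bool × ℕ × ℕ) : 0 < digitVal m x := by
  have := placeVal_le hm x
  omega

/-- The values are `1`, `2`, `-1` or `-2` modulo `m`, which reveals sign and exponent. -/
theorem digitVal_injOn {m : ℕ} (hm : 31 ≤ m) {x y : Bool × ℕ × ℕ} (hx : x.2.2 ≤ 1)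
    (hy : y.2.2 ≤ 1) (h : digitVal m x = digitVal m y) : x = y := by
  have key : ∀ z : Bool × ℕ × ℕ, z.2.2 ≤ 1 → digitVal m z % m =
      if z.1 then z.2.2 + 1 else m - (z.2.2 + 1) := by
    rintro ⟨s, j, k⟩ hz
    have hk : k = 0 ∨ k = 1 := by simp at hz; omega
    rcases hk with rfl | rfl <;> cases s <;>
      simp only [digitVal, partVal, if_true, Bool.false_eq_true, if_false]
    · rw [show 2 ^ 0 * ((j + 2) * m - 1) = m - (0 + 1) + m * (j + 1) by
        rw [add_mul, mul_add, mul_comm m j]; omega]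
      rw [Nat.add_mul_mod_self_left, Nat.mod_eq_of_lt (by omega)]
    · rw [show 2 ^ 0 * ((j + 1) * m + 1) = 0 + 1 + m * (j + 1) by ring]
      rw [Nat.add_mul_mod_self_left, Nat.mod_eq_of_lt (by omega)]
    · rw [show 2 ^ 1 * ((j + 2) * m - 1) = m - (1 + 1) + m * (2 * j + 3) by
        rw [add_mul, mul_add, mul_left_comm m 2, mul_comm m j]; omega]
      rw [Nat.add_mul_mod_self_left, Nat.mod_eq_of_lt (by omega)]
    · rw [show 2 ^ 1 * ((j + 1) * m + 1) = 1 + 1 + m * (2 * j + 2) by ring]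
      rw [Nat.add_mul_mod_self_left, Nat.mod_eq_of_lt (by omega)]
  have h1 := key x hx
  rw [h, key y hy] at h1
  obtain ⟨s, j, k⟩ := x
  obtain ⟨s', j', k'⟩ := y
  have hm0 : 0 < m := by omega
  simp only at hx hy h1
  have hk : k = k' := by split_ifs at h1 <;> omega
  have hs : s = s' := by cases s <;> cases s' <;> simp at h1 ⊢ <;> omega
  subst hk hs
  have h2 : partVal m s j = partVal m s j' :=
    Nat.eq_of_mul_eq_mul_left (Nat.two_pow_pos k) h
  cases s
  · have h3 : 0 < (j + 2) * m := by positivity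
    have h4 : 0 < (j' + 2) * m := by positivity
    simp only [partVal] at h2
    have := Nat.eq_of_mul_eq_mul_right hm0 (show (j + 2) * m = (j' + 2) * m by omega)
    simp; omega
  · simp only [partVal] at h2
    have := Nat.eq_of_mul_eq_mul_right hm0 (show (j + 1) * m = (j' + 1) * m by omega)
    simp; omega

/-! ### Discarding one digit to make room for the largest part. -/

theorem exists_trim (m : ℕ) (D : Finset (Bool × ℕ × ℕ)) : ∃ D' : Finset (Bool × ℕ × ℕ),
    (D' = D ∧ ∀ x ∈ D, 2 ≤ x.2.2) ∨
      ∃ x ∈ D, x.2.2 ≤ 1 ∧ D' = D.erase x ∧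
        ∀ y ∈ D, y.2.2 ≤ 1 → digitVal m y ≤ digitVal m x := by
  by_cases h : ∃ x ∈ D, x.2.2 ≤ 1
  · obtain ⟨x, hx, hmax⟩ := exists_max_image {x ∈ D | x.2.2 ≤ 1} (digitVal m)
      (by simpa [Finset.Nonempty] using h)
    rw [mem_filter] at hx
    exact ⟨_, Or.inr ⟨x, hx.1, hx.2, rfl, fun y hy hy1 => hmax y (mem_filter.2 ⟨hy, hy1⟩)⟩⟩
  · push Not at h
    exact ⟨D, Or.inl ⟨rfl, fun x hx => h x hx⟩⟩

/-- Removal of the largest binary digit among those with exponents `0` and `1`. -/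
noncomputable def trim (m : ℕ) (D : Finset (Bool × ℕ × ℕ)) : Finset (Bool × ℕ × ℕ) :=
  (exists_trim m D).choose

theorem trim_spec (m : ℕ) (D : Finset (Bool × ℕ × ℕ)) :
    (trim m D = D ∧ ∀ x ∈ D, 2 ≤ x.2.2) ∨
      ∃ x ∈ D, x.2.2 ≤ 1 ∧ trim m D = D.erase x ∧
        ∀ y ∈ D, y.2.2 ≤ 1 → digitVal m y ≤ digitVal m x :=
  (exists_trim m D).choose_spec

section Trim

variable {m : ℕ} (hm : 31 ≤ m) {D E : Finset (Bool × ℕ × ℕ)}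

include hm

theorem trim_injective (h : trim m D = trim m E)
    (hs : ∑ x ∈ D, digitVal m x = ∑ x ∈ E, digitVal m x) : D = E := by
  rcases trim_spec m D with ⟨hD, _⟩ | ⟨x, hx, hx1, hD, _⟩ <;>
    rcases trim_spec m E with ⟨hE, _⟩ | ⟨y, hy, hy1, hE, _⟩
  · rw [← hD, h, hE]
  · rw [← add_sum_erase E _ hy, ← hE, ← h, hD] at hs
    have := digitVal_pos hm y
    omega
  · rw [← add_sum_erase D _ hx, ← hD, h, hE] at hs
    have := digitVal_pos hm x
    omega
  · rw [← add_sum_erase D _ hx, ← add_sum_erase E _ hy, ← hD, ← hE, h] at hs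
    have hxy : x = y := digitVal_injOn hm hx1 hy1 (Nat.add_right_cancel hs)
    rw [← insert_erase hx, ← insert_erase hy, ← hD, ← hE, h, hxy]

/-- The extra copy of `placeVal m x + m` is paid by `x` itself when its exponent is at least `2`,
and otherwise by the discarded digit, whose value is at least that of `x`. -/
theorem sum_trim_add_le : ∀ x ∈ trim m D,
    ∑ y ∈ trim m D, (placeVal m y + m) + (placeVal m x + m) ≤ ∑ y ∈ D, digitVal m y := by
  intro x hx
  by_cases hx2 : 2 ≤ x.2.2
  · have hsub : trim m D ⊆ D := by
      rcases trim_spec m D with ⟨hD, _⟩ | ⟨z, _, _, hD, _⟩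
      · rw [hD]
      · rw [hD]; exact erase_subset _ _
    have h1 : ∑ y ∈ trim m D, digitVal m y ≤ ∑ y ∈ D, digitVal m y :=
      sum_le_sum_of_subset hsub
    have h2 : ∑ y ∈ (trim m D).erase x, (placeVal m y + m) ≤
        ∑ y ∈ (trim m D).erase x, digitVal m y := sum_le_sum fun y _ => placeVal_le hm y
    rw [← add_sum_erase _ _ hx] at h1 ⊢
    have := two_mul_placeVal_le hm hx2
    omega
  · rcases trim_spec m D with ⟨hD, hall⟩ | ⟨z, hz, _, hD, hmax⟩
    · exact absurd (hall x (hD ▸ hx)) hx2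
    · have h1 : ∑ y ∈ trim m D, (placeVal m y + m) ≤ ∑ y ∈ trim m D, digitVal m y :=
        sum_le_sum fun y _ => placeVal_le hm y
      rw [hD] at hx
      have h2 := hmax x (mem_of_mem_erase hx) (by omega)
      have h3 := placeVal_le hm x
      rw [← add_sum_erase D _ hz, ← hD]
      omega

end Trim

/-! ### Coding a set of digits by a multiset. -/

/-- The indices of the distinct parts of the class `i` which replace the binary digits in `D`. -/
def places (D : Finset (Bool × ℕ × ℕ)) (i : ℕ) : Finset ℕ :=
  {x ∈ D | (place x).1 = i}.image fun x => (place x).2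

theorem place_snd_mem_places {D : Finset (Bool × ℕ × ℕ)} {x : Bool × ℕ × ℕ} :
    (place x).2 ∈ places D (place x).1 ↔ x ∈ D := by
  simp only [places, mem_image, mem_filter]
  constructor
  · rintro ⟨y, ⟨hy, h1⟩, h2⟩
    rwa [← place_injective (Prod.ext h1 h2)]
  · exact fun hx => ⟨x, ⟨hx, rfl⟩, rfl⟩

theorem places_injective {D E : Finset (Bool × ℕ × ℕ)} (h : ∀ i < 5, places D i = places E i) :
    D = E := by
  ext x
  rw [← place_snd_mem_places, h _ (place_fst_lt x), place_snd_mem_places]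

theorem sum_places (D : Finset (Bool × ℕ × ℕ)) (F : ℕ → ℕ → ℕ) :
    ∑ i ∈ range 5, ∑ u ∈ places D i, F i u = ∑ x ∈ D, F (place x).1 (place x).2 := by
  rw [← sum_fiberwise_of_maps_to (s := D) (t := range 5) (g := fun x => (place x).1)
    fun x _ => mem_range.2 (place_fst_lt x)]
  refine sum_congr rfl fun i _ => ?_
  rw [places, sum_image]
  · exact sum_congr rfl fun x hx => by rw [(mem_filter.1 hx).2]
  · intro x hx y hy h
    simp only [coe_filter, Set.mem_ofPred_eq] at hx hy
    exact place_injective (Prod.ext (hx.2.trans hy.2.symm) h)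

/-- The multiset coding a set of binary digits. -/
noncomputable def digitCode (m : ℕ) (D : Finset (Bool × ℕ × ℕ)) : Multiset ℕ :=
  code m (places (trim m D)) 5

section DigitCode

variable {m : ℕ} (hm : 31 ≤ m) {D E : Finset (Bool × ℕ × ℕ)}

include hm

theorem digitCode_injective (h : digitCode m D = digitCode m E)
    (hs : ∑ x ∈ D, digitVal m x = ∑ x ∈ E, digitVal m x) : D = E :=
  trim_injective hm (places_injective (code_injective (by omega) h)) hs

omit hm in
theorem weight_digitCode : weight m (digitCode m D) = ∑ x ∈ trim m D, placeVal m x := by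
  rw [digitCode, weight_code, sum_places _ fun i u => 2 ^ i + m * u]
  rfl

/-- This says that the remainder `N - weight` exceeds every coded part by at least `m`. -/
theorem digitCode_le : ∀ y ∈ digitCode m D,
    weight m (digitCode m D) + (y + 1 + m * (digitCode m D).card) ≤ ∑ x ∈ D, digitVal m x := by
  intro y hy
  rw [weight_digitCode]
  have hsum : ∑ i ∈ range 5, #(places (trim m D) i) = #(trim m D) := by
    simpa using sum_places (trim m D) fun _ _ => 1
  have hne : (trim m D).Nonempty := by
    rw [nonempty_iff_ne_empty]
    intro h
    simp [digitCode, h, places, code, combine, large] at hy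
  obtain ⟨x, hx, hmax⟩ := exists_max_image _ (placeVal m) hne
  have h1 := sum_trim_add_le hm x hx
  have h2 := code_le (m := m) (C := places (trim m D)) (r := 5) (by omega)
    (T := placeVal m x + m) (by
      intro i _ u hu
      simp only [places, mem_image, mem_filter] at hu
      obtain ⟨z, ⟨hz, rfl⟩, rfl⟩ := hu
      exact Nat.add_le_add_right (hmax z hz) m) y hy
  rw [hsum] at h2
  rw [sum_add_distrib, sum_const, smul_eq_mul, mul_comm] at h1
  rw [digitCode]
  omega

end DigitCode

/-! ### From multiplicities to binary digits. -/

/-- The sum over the binary digits of a family of multiplicities. -/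
theorem sum_bitIndices {m M : ℕ} (f : Bool → ℕ → ℕ) :
    ∑ x ∈ (univ ×ˢ range M : Finset (Bool × ℕ)).sigma fun sj =>
        (f sj.1 sj.2).bitIndices.toFinset, digitVal m (x.1.1, x.1.2, x.2) =
      ∑ sj ∈ (univ ×ˢ range M : Finset (Bool × ℕ)), f sj.1 sj.2 * partVal m sj.1 sj.2 := by
  rw [sum_sigma]
  refine sum_congr rfl fun sj _ => ?_
  simp only [digitVal]
  rw [← sum_mul, sum_toFinset_bitIndices_two_pow]

/-- The binary digits of the multiplicities of the parts `a * partVal m s j` with `j < M`. -/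
def digits (a m M : ℕ) (S : Multiset ℕ) : Finset (Bool × ℕ × ℕ) :=
  ((univ ×ˢ range M : Finset (Bool × ℕ)).sigma fun sj =>
    (S.count (a * partVal m sj.1 sj.2)).bitIndices.toFinset).image fun x => (x.1.1, x.1.2, x.2)

theorem mem_digits {a m M : ℕ} {S : Multiset ℕ} {s : Bool} {j k : ℕ} :
    (s, j, k) ∈ digits a m M S ↔ j < M ∧ (S.count (a * partVal m s j)).testBit k := by
  simp only [digits, mem_image, mem_sigma, mem_product, mem_univ, true_and, mem_range,
    List.mem_toFinset, Nat.mem_bitIndices]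
  constructor
  · rintro ⟨⟨⟨s', j'⟩, k'⟩, h, h'⟩
    simp only [Prod.mk.injEq] at h'
    obtain ⟨rfl, rfl, rfl⟩ := h'
    exact h
  · exact fun h => ⟨⟨⟨s, j⟩, k⟩, h, rfl⟩

theorem partVal_injective {m : ℕ} (hm : 31 ≤ m) {s s' : Bool} {j j' : ℕ}
    (h : partVal m s j = partVal m s' j') : (s, j) = (s', j') := by
  have := digitVal_injOn hm (x := (s, j, 0)) (y := (s', j', 0)) (by simp) (by simp)
    (by simp [digitVal, h])
  simpa using this

theorem sum_digits {a m M : ℕ} (ha : 0 < a) (hm : 31 ≤ m) {S : Multiset ℕ}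
    (hS : ∀ x ∈ S, ∃ s, ∃ j < M, x = a * partVal m s j) :
    a * ∑ x ∈ digits a m M S, digitVal m x = S.sum := by
  have hsub : S.toFinset ⊆ (univ ×ˢ range M : Finset (Bool × ℕ)).image
      fun sj => a * partVal m sj.1 sj.2 := by
    intro x hx
    obtain ⟨s, j, hj, rfl⟩ := hS x (by simpa using hx)
    exact mem_image.2 ⟨(s, j), by simpa using hj, rfl⟩
  rw [sum_multiset_count_of_subset S _ hsub, sum_image, digits, sum_image,
    sum_bitIndices fun s j => S.count (a * partVal m s j), mul_sum]
  · exact sum_congr rfl fun sj _ => by rw [smul_eq_mul]; ring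
  · rintro ⟨⟨s, j⟩, k⟩ _ ⟨⟨s', j'⟩, k'⟩ _ h
    simp only [Prod.mk.injEq] at h
    obtain ⟨rfl, rfl, rfl⟩ := h
    rfl
  · rintro ⟨s, j⟩ _ ⟨s', j'⟩ _ h
    exact partVal_injective hm (Nat.eq_of_mul_eq_mul_left ha h)

theorem digits_injective {a m M : ℕ} {S S' : Multiset ℕ}
    (hS : ∀ x ∈ S, ∃ s, ∃ j < M, x = a * partVal m s j)
    (hS' : ∀ x ∈ S', ∃ s, ∃ j < M, x = a * partVal m s j)
    (h : digits a m M S = digits a m M S') : S = S' := by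
  have key : ∀ s, ∀ j < M, S.count (a * partVal m s j) = S'.count (a * partVal m s j) := by
    intro s j hj
    refine Nat.eq_of_testBit_eq fun k => ?_
    have := congrArg ((s, j, k) ∈ ·) h
    simp only [mem_digits, hj, true_and, eq_iff_iff] at this
    exact Bool.eq_iff_iff.2 this
  ext x
  by_cases hx : ∃ s, ∃ j < M, x = a * partVal m s j
  · obtain ⟨s, j, hj, rfl⟩ := hx
    exact key s j hj
  · rw [Multiset.count_eq_zero.2 fun h => hx (hS x h),
      Multiset.count_eq_zero.2 fun h => hx (hS' x h)]

/-- Congruence to `±a` modulo `a * m` forces divisibility by `a`; the two excluded values are the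
first terms of the two progressions. The bound `j < n` is crude and serves only finiteness. -/
theorem exists_eq_mul_partVal {a m n : ℕ} {d : ℕ} (ha : 0 < a) (hm : 31 ≤ m) (hd : d + 3 = a * m)
    {p : n.Partition} (hp : p ∈ residuePartitions d a n) :
    ∀ x ∈ p.parts, ∃ s, ∃ j < n, x = a * partVal m s j := by
  intro x hx
  have h := (mem_filter.1 hp).2 x hx
  have hpos := p.parts_pos hx
  have hle : x ≤ n := by
    conv_rhs => rw [← p.parts_sum]
    exact Multiset.le_sum_of_mem hx
  have hd' : (d : ℤ) + 3 = a * m := by exact_mod_cast hd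
  rw [hd'] at h
  obtain ⟨h1, h2, h3⟩ := h
  have ha' : (0 : ℤ) < a := by exact_mod_cast ha
  have hm' : (31 : ℤ) ≤ m := by exact_mod_cast hm
  have hx' : (0 : ℤ) < x := by exact_mod_cast hpos
  have haj : ∀ s j, x = a * partVal m s j → j < n := by
    rintro s j rfl
    have h4 : j < partVal m s j := by
      cases s
      · have : (j + 2) * 31 ≤ (j + 2) * m := Nat.mul_le_mul_left _ hm
        simp only [partVal]; omega
      · have : (j + 1) * 31 ≤ (j + 1) * m := Nat.mul_le_mul_left _ hm
        simp only [partVal]; omega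
    calc j < partVal m s j := h4
      _ ≤ a * partVal m s j := Nat.le_mul_of_pos_left _ ha
      _ ≤ n := hle
  suffices H : ∃ s j, x = a * partVal m s j by
    obtain ⟨s, j, h⟩ := H
    exact ⟨s, j, haj s j h, h⟩
  rcases h1 with h1 | h1
  · obtain ⟨t, ht⟩ := h1.symm.dvd
    have hxt : (x : ℤ) = a * (t * m + 1) := by linear_combination ht
    have h4 : 0 < t * (m : ℤ) + 1 := by
      rw [hxt] at hx'
      exact (mul_pos_iff_of_pos_left ha').1 hx'
    have h5 : 0 ≤ t := by
      by_contra hneg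
      nlinarith
    have h6 : t ≠ 0 := by
      rintro rfl
      exact h2 (by rw [hxt]; ring)
    obtain ⟨j, rfl⟩ : ∃ j : ℕ, t = j + 1 := ⟨(t - 1).toNat, by omega⟩
    refine ⟨true, j, ?_⟩
    zify
    rw [hxt]
    simp [partVal]
  · obtain ⟨t, ht⟩ := h1.symm.dvd
    have hxt : (x : ℤ) = a * (t * m - 1) := by linear_combination ht
    have h4 : 0 < t * (m : ℤ) - 1 := by
      rw [hxt] at hx'
      exact (mul_pos_iff_of_pos_left ha').1 hx'
    have h5 : 0 < t := by
      by_contra hneg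
      nlinarith
    have h6 : t ≠ 1 := by
      rintro rfl
      exact h3 (by rw [hxt]; ring)
    obtain ⟨j, rfl⟩ : ∃ j : ℕ, t = j + 2 := ⟨(t - 2).toNat, by omega⟩
    refine ⟨false, j, ?_⟩
    have h7 : 1 ≤ (j + 2) * m := by nlinarith
    simp only [partVal]
    zify [h7]
    rw [hxt]

/-! ### Decoding into a partition with a new largest part. -/

section GapList

/-- The parts, in decreasing order, of the partition coded by `W` with an additional largest part
which makes the sum `N`, all multiplied by `a`. -/
noncomputable def gapList (a m N : ℕ) (W : Multiset ℕ) : List ℕ :=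
  (a * (N - weight m W)) ::
    (List.range W.card).map fun i => a * (desc W i + 1 + m * (W.card - 1 - i))

variable {a m N : ℕ} {W : Multiset ℕ}

theorem sum_gapList (h : weight m W ≤ N) : (gapList a m N W).sum = a * N := by
  have h1 : ((List.range W.card).map fun i => a * (desc W i + 1 + m * (W.card - 1 - i))).sum =
      ∑ i ∈ range W.card, a * (desc W i + 1 + m * (W.card - 1 - i)) := rfl
  have h2 : (W.map (· + 1)).sum = ∑ i ∈ range W.card, (desc W i + 1) := by
    conv_lhs => rw [← map_range_desc W, Multiset.map_map]
    rfl
  rw [gapList, List.sum_cons, h1, ← mul_sum, ← mul_add]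
  congr 1
  have h3 : ∑ i ∈ range W.card, (desc W i + 1 + m * (W.card - 1 - i)) = weight m W := by
    rw [sum_add_distrib, ← mul_sum, sum_range_reflect (fun i => i), weight, h2]
  rw [h3, Nat.sub_add_cancel h]

theorem pairwise_gapList (h : ∀ y ∈ W, weight m W + (y + 1 + m * W.card) ≤ N) :
    (gapList a m N W).Pairwise fun x y => y + a * m ≤ x := by
  rw [gapList, List.pairwise_cons, List.pairwise_map]
  constructor
  · intro x hx
    simp only [List.mem_map, List.mem_range] at hx
    obtain ⟨i, hi, rfl⟩ := hx
    rw [← mul_add]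
    refine Nat.mul_le_mul_left a ?_
    have h1 := h _ (desc_mem W hi)
    have h2 : m * (W.card - 1 - i) + m ≤ m * W.card := by
      rw [← Nat.mul_succ]
      exact Nat.mul_le_mul_left m (by omega)
    omega
  · refine List.Pairwise.imp_of_mem ?_ List.pairwise_lt_range
    intro i j _ hj hij
    rw [List.mem_range] at hj
    rw [← mul_add]
    refine Nat.mul_le_mul_left a ?_
    have h1 := desc_anti W hij.le hj
    have h2 : m * (W.card - 1 - j) + m ≤ m * (W.card - 1 - i) := by
      rw [← Nat.mul_succ]
      exact Nat.mul_le_mul_left m (by omega)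
    omega

theorem le_of_mem_gapList (hN : weight m W < N) : ∀ x ∈ gapList a m N W, a ≤ x := by
  intro x hx
  rw [gapList, List.mem_cons, List.mem_map] at hx
  rcases hx with rfl | ⟨i, _, rfl⟩
  · exact Nat.le_mul_of_pos_right _ (by omega)
  · exact Nat.le_mul_of_pos_right _ (by omega)

/-- The tail alone determines `W`: its length fixes the staircase. -/
theorem gapList_injective (ha : 0 < a) {W' : Multiset ℕ}
    (h : gapList a m N W = gapList a m N W') : W = W' := by
  have h1 := (List.cons.inj h).2
  have hc : W.card = W'.card := by simpa using congrArg List.length h1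
  refine eq_of_desc_eq hc fun i hi => ?_
  rw [← hc] at h1
  have h2 := Nat.eq_of_mul_eq_mul_left ha (List.map_inj_left.1 h1 i (by simpa using hi))
  omega

theorem sort_gapList (h : ∀ y ∈ W, weight m W + (y + 1 + m * W.card) ≤ N) :
    (gapList a m N W : Multiset ℕ).sort (· ≥ ·) = gapList a m N W := by
  refine List.Perm.eq_of_pairwise (le := (· ≥ ·)) (fun a b _ _ h1 h2 => le_antisymm h2 h1)
    (Multiset.pairwise_sort _ _) ((pairwise_gapList h).imp fun h => by omega) ?_
  rw [← Multiset.coe_eq_coe, Multiset.sort_eq]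

theorem weight_lt (hN : 0 < N) (h : ∀ y ∈ W, weight m W + (y + 1 + m * W.card) ≤ N) :
    weight m W < N := by
  rcases W.empty_or_exists_mem with rfl | ⟨y, hy⟩
  · simpa [weight] using hN
  · have := h y hy
    omega

end GapList

/-! ### Assembling the injection. -/

theorem QDashDash_le_q {a m d n : ℕ} (ha : 0 < a) (hm : 31 ≤ m) (hd : d + 3 = a * m)
    (hn : 0 < n) : QDashDash d a n ≤ q d a n := by
  have hpart := fun {p} => exists_eq_mul_partVal (n := n) (p := p) ha hm hd
  have hsum : ∀ p ∈ residuePartitions d a n,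
      a * ∑ x ∈ digits a m n p.parts, digitVal m x = n := fun p hp => by
    rw [sum_digits ha hm (hpart hp), p.parts_sum]
  -- Any counted partition has only multiples of `a` as parts, so unless there is none, `a` divides
  -- `n`.
  rcases (residuePartitions d a n).eq_empty_or_nonempty with he | ⟨p₀, hp₀⟩
  · simp [QDashDash, he]
  obtain ⟨N, rfl⟩ : ∃ N, n = a * N := ⟨_, (hsum p₀ hp₀).symm⟩
  have hN : 0 < N := Nat.pos_of_mul_pos_left hn
  have hsum' : ∀ p ∈ residuePartitions d a (a * N),
      ∑ x ∈ digits a m (a * N) p.parts, digitVal m x = N :=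
    fun p hp => Nat.eq_of_mul_eq_mul_left ha (hsum p hp)
  let W (p : (a * N).Partition) : Multiset ℕ := digitCode m (digits a m (a * N) p.parts)
  have hW : ∀ p ∈ residuePartitions d a (a * N), ∀ y ∈ W p,
      weight m (W p) + (y + 1 + m * (W p).card) ≤ N := fun p hp y hy =>
    (digitCode_le hm y hy).trans_eq (hsum' p hp)
  have hex : ∀ p ∈ residuePartitions d a (a * N), ∃ r ∈ gapPartitions d a (a * N),
      r.parts = gapList a m N (W p) := by
    intro p hp
    have hlt := weight_lt hN (hW p hp)
    have hle := le_of_mem_gapList (a := a) hlt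
    refine ⟨⟨gapList a m N (W p), fun {x} hx => ha.trans_le (hle x hx), ?_⟩, ?_, rfl⟩
    · rw [Multiset.sum_coe, sum_gapList hlt.le]
    · rw [gapPartitions, mem_filter]
      refine ⟨mem_univ _, hle, ?_⟩
      rw [sort_gapList (hW p hp)]
      -- The gaps are `a * m = d + 3`, more than the required `d`.
      exact (pairwise_gapList (hW p hp)).imp fun h => by omega
  choose! F hF hFparts using hex
  refine card_le_card_of_injOn F hF fun p hp p' hp' h => ?_
  have h1 := congrArg (fun r => r.parts.sort (· ≥ ·)) h
  simp only [hFparts p hp, hFparts p' hp', sort_gapList (hW p hp), sort_gapList (hW p' hp')] at h1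
  have h2 := digitCode_injective hm (gapList_injective ha h1)
    ((hsum' p hp).trans (hsum' p' hp').symm)
  exact Nat.Partition.ext (digits_injective (hpart hp) (hpart hp') h2)

end AlderPartitions

theorem mainTheorem4 (a d : ℕ) (ha : 3 ≤ a) (hd : 31 * (a : ℤ) - 3 ≤ (d : ℤ)) (hdvd : a ∣ d + 3)
    (n : ℕ) (hn : 1 ≤ n) : 0 ≤ AlderPartitions.deltaDashDash d a n := by
  obtain ⟨m, hm⟩ := hdvd
  have h1 : a * 31 ≤ a * m := by omega
  have h2 := AlderPartitions.QDashDash_le_q (by omega)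
    (Nat.le_of_mul_le_mul_left h1 (by omega)) hm hn
  rw [AlderPartitions.deltaDashDash, AlderPartitions.deltaDashDash₂]
  omega
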